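/- Let $\mathbb{R}^+=(0,\infty)$. For $(x,y,t),(x_0,y_0,t_0)\in\mathbb{R}^+\times\mathbb{R}^2$ with $t>t_0$ let $$\Psi(x,y,t;x_0,y_0,t_0)=\inf_{\omega}\int_0^{t-t_0}\omega(s)^2\,ds\in[0,\infty],$$ where the infimum is over all $\omega\in L^1([0,t-t_0])$ for which the system $\dot q_1=\omega q_1$, $\dot q_2=q_1$ on $[0,t-t_0]$ has an absolutely continuous solution (the equations holding almost everywhere) with values in $\mathbb{R}^+\times\mathbb{R}$, $(q_1,q_2)(0)=(x,y)$ and $(q_1,q_2)(t-t_0)=(x_0,y_0)$. Set $\Psi=+\infty$ if there is no such $\omega$, or if $t\le t_0$. Let $$g(r)=\begin{cases}\dfrac{\sinh\sqrt r}{\sqrt r}, & r>0,\\[1ex] 1, & r=0,\\[1ex] \dfrac{\sin\sqrt{-r}}{\sqrt{-r}}, & -\pi^2<r<0.\end{cases}$$ Then the following hold. The function $g$ is a bijection from $(-\pi^2,\infty)$ onto $(0,\infty)$. Let $x,x_0>0$, $t_0<t$ and $y<y_0$, and put $$\rho=\frac{y_0-y}{(t-t_0)\sqrt{x x_0}},\qquad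 E=\frac{4}{(t-t_0)^2}\,g^{-1}(\rho).$$ Then $E>-\frac{4\pi^2}{(t-t_0)^2}$, $E+\frac{4xx_0}{(y_0-y)^2}\ge 0$, $\Psi(x,y,t;x_0,y_0,t_0)$ is finite, and $$\Psi(x,y,t;x_0,y_0,t_0)=\begin{cases}E(t-t_0)+\dfrac{4(x+x_0)}{y_0-y}-4\sqrt{E+\dfrac{4xx_0}{(y_0-y)^2}}, & \text{if } E\ge-\dfrac{\pi^2}{(t-t_0)^2},\\[2ex] E(t-t_0)+\dfrac{4(x+x_0)}{y_0-y}+4\sqrt{E+\dfrac{4xx_0}{(y_0-y)^2}}, & \text{if } -\dfrac{4\pi^2}{(t-t_0)^2}<E<-\dfrac{\pi^2}{(t-t_0)^2}.\end{cases}$$ Moreover, $$\frac{\Psi(x,y,t;x_0,y_0,t_0)}{\frac{4}{t-t_0}\log^2\rho+\frac{4(x_0+x)}{y_0-y}}\to1\quad\text{as }\rho\to+\infty,\qquad \frac{\Psi(x,y,t;x_0,y_0,t_0)}{\frac{4(\sqrt x+\sqrt{x_0})^2}{y_0-y}-\frac{4\pi^2}{t-t_0}}\to1\quad\text{as }\rho\to0,$$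 where both limits are uniform over all $(x,y,t),(x_0,y_0,t_0)\in\mathbb{R}^+\times\mathbb{R}^2$ with $t_0<t$ and $y<y_0$: for every $\varepsilon>0$ there is a threshold for $\rho$, depending only on $\varepsilon$, beyond which (respectively below which) the quotient differs from $1$ by less than $\varepsilon$. -/

import Mathlib

open Set MeasureTheory
open scoped ENNReal

noncomputable section

/-- The control `ω ∈ L¹([0, T])` steers `(x, y)` to `(x₀, y₀)` in time `T` along the trajectory
`(q₁, q₂)`, which stays in `ℝ⁺ × ℝ` and solves `q₁' = ω q₁`, `q₂' = q₁` in the sense of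
Carathéodory. For an integrable control this means exactly that `(q₁, q₂)` solves the integrated
equations (absolutely continuous trajectories solving the differential equations almost
everywhere). -/
structure Steers (T x y x₀ y₀ : ℝ) (ω q₁ q₂ : ℝ → ℝ) : Prop where
  integrable_control : IntegrableOn ω (Icc 0 T)
  continuousOn_fst : ContinuousOn q₁ (Icc 0 T)
  pos_fst : ∀ s ∈ Icc 0 T, 0 < q₁ s
  eq_fst : ∀ s ∈ Icc 0 T, q₁ s = x + ∫ τ in (0 : ℝ)..s, ω τ * q₁ τ
  eq_snd : ∀ s ∈ Icc 0 T, q₂ s = y + ∫ τ in (0 : ℝ)..s, q₁ τ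
  end_fst : q₁ T = x₀
  end_snd : q₂ T = y₀

/-- The quadratic cost `∫₀ᵀ ω²`; it is `∞` for a control that is not square integrable. -/
def controlCost (T : ℝ) (ω : ℝ → ℝ) : ℝ≥0∞ :=
  ∫⁻ s in Icc 0 T, ENNReal.ofReal (ω s ^ 2)

/-- The value function `Ψ(x, y, t; x₀, y₀, t₀)`: the infimum of the cost over the controls in
`L¹([0, t - t₀])` that steer `(x, y)` to `(x₀, y₀)` in time `t - t₀ > 0`. It is `∞` if there is
no such control. -/
def valueFunction (x y t x₀ y₀ t₀ : ℝ) : ℝ≥0∞ :=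
  ⨅ (ω : ℝ → ℝ)
    (_ : t₀ < t ∧ ∃ q₁ q₂ : ℝ → ℝ, Steers (t - t₀) x y x₀ y₀ ω q₁ q₂),
    controlCost (t - t₀) ω

/-- `g(r) = sinh √r / √r` for `r > 0`, `g(0) = 1`, `g(r) = sin √(-r) / √(-r)` for
`-π² < r < 0`. Only its values on `(-π², ∞)` are used. -/
def gFun (r : ℝ) : ℝ :=
  if 0 < r then Real.sinh (√r) / √r
  else if r = 0 then 1
  else Real.sin (√(-r)) / √(-r)

/-- The inverse of `gFun` as a function on `(-π², ∞)`. -/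
def gInv : ℝ → ℝ := Function.invFunOn gFun (Ioi (-Real.pi ^ 2))

/-- The quotient `(y₀ - y) / ((t - t₀) √(x x₀))`. -/
def steeringRatio (x y t x₀ y₀ t₀ : ℝ) : ℝ :=
  (y₀ - y) / ((t - t₀) * √(x * x₀))

/-- `E = 4 / (t - t₀)² · g⁻¹((y₀ - y) / ((t - t₀) √(x x₀)))`. -/
def energyE (x y t x₀ y₀ t₀ : ℝ) : ℝ :=
  4 / (t - t₀) ^ 2 * gInv (steeringRatio x y t x₀ y₀ t₀)

end

open Filter Topology

/-! Write `T = t - t₀`, `d = y₀ - y`. For real `k` the planar curve `z = √q₁ e^{iks}` satisfies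
`|z'|² = q₁ (ω²/4 + k²)`; parametrised by `q₂`, it has four times its energy equal to the cost plus
`4k²T`. A chord minimises energy, so every `k` yields a lower bound (`Steers.cos_le_controlCost`).
Replacing `k` by `ik` makes the quadratic form indefinite, and an explicit calibration gives the
analogous bound (`Steers.cosh_le_controlCost`).

Conversely `q₁ = v⁻²` with `v'' = κ v` is steered by `ω = -2v'/v`, whose square has an elementary
antiderivative. Hitting `y₀` means `g(κT²) = ρ`, and for `k² = |κ|` the cost equals the lower bound
(`valueFunction_eq`).

With `r = g⁻¹(ρ)` this reads `Ψ = 4r/T + 4(x + x₀)/d - 8 cosFun r / (Tρ)`. As `cosFun² = 1 + r g²`,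
the last term is `±4√(E + 4xx₀/d²)`, the sign changing where the cosine does. In the asymptotics the
error is a function of `ρ` times a power of `T`, which gives uniformity. -/

/-! ### Absolute continuity under composition. -/

theorem AbsolutelyContinuousOnInterval.lipschitzOnWith_comp {f G : ℝ → ℝ} {a b : ℝ} {K : NNReal}
    {s : Set ℝ} (hG : LipschitzOnWith K G s) (hf : AbsolutelyContinuousOnInterval f a b)
    (hs : MapsTo f (uIcc a b) s) : AbsolutelyContinuousOnInterval (fun t ↦ G (f t)) a b := by
  rw [absolutelyContinuousOnInterval_iff] at hf ⊢
  intro ε hε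
  -- `K + 1` rather than `K` covers `K = 0`.
  obtain ⟨δ, hδ, h⟩ := hf (ε / (K + 1)) (by positivity)
  refine ⟨δ, hδ, fun I hI hlen ↦ ?_⟩
  calc _ ≤ ∑ i ∈ Finset.range I.1, K * dist (f (I.2 i).1) (f (I.2 i).2) :=
        Finset.sum_le_sum fun i hi ↦ hG.dist_le_mul _ (hs (hI.1 i hi).1) _ (hs (hI.1 i hi).2)
    _ = K * ∑ i ∈ Finset.range I.1, dist (f (I.2 i).1) (f (I.2 i).2) := Finset.mul_sum .. |>.symm
    _ ≤ K * (ε / (K + 1)) := by gcongr; exact (h I hI hlen).le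
    _ < (K + 1) * (ε / (K + 1)) := by gcongr; linarith
    _ = ε := by field

/-- The image of `f` is a compact interval, on which a C¹ function is Lipschitz. This serves root,
inverse and logarithm on `Ioi 0`, where they are not globally Lipschitz. -/
theorem AbsolutelyContinuousOnInterval.contDiffOn_comp {f G : ℝ → ℝ} {a b : ℝ} {s : Set ℝ}
    (hG : ContDiffOn ℝ 1 G s) (hf : AbsolutelyContinuousOnInterval f a b)
    (hs : MapsTo f (uIcc a b) s) : AbsolutelyContinuousOnInterval (fun t ↦ G (f t)) a b := by
  have him := hf.continuousOn.image_uIcc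
  rw [uIcc_of_le (Real.sInf_le_sSup _ (isCompact_uIcc.image_of_continuousOn hf.continuousOn).bddBelow
    (isCompact_uIcc.image_of_continuousOn hf.continuousOn).bddAbove)] at him
  have hsub : Icc (sInf (f '' uIcc a b)) (sSup (f '' uIcc a b)) ⊆ s := by
    rw [← him]; exact hs.image_subset
  obtain ⟨K, hK⟩ := (hG.mono hsub).exists_lipschitzOnWith (by decide) (convex_Icc _ _)
    isCompact_Icc
  refine hf.lipschitzOnWith_comp hK fun t ht ↦ ?_
  rw [← him]; exact mem_image_of_mem f ht

theorem AbsolutelyContinuousOnInterval.congr_uIcc {f g : ℝ → ℝ} {a b : ℝ} (hf : AbsolutelyContinuousOnInterval f a b)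
    (h : EqOn f g (uIcc a b)) : AbsolutelyContinuousOnInterval g a b := by
  rw [absolutelyContinuousOnInterval_iff] at hf ⊢
  intro ε hε
  obtain ⟨δ, hδ, H⟩ := hf ε hε
  refine ⟨δ, hδ, fun I hI hlen ↦ lt_of_eq_of_lt ?_ (H I hI hlen)⟩
  exact Finset.sum_congr rfl fun i hi ↦ by rw [h (hI.1 i hi).1, h (hI.1 i hi).2]

theorem absolutelyContinuousOnInterval_const (c a b : ℝ) : AbsolutelyContinuousOnInterval (fun _ ↦ c) a b :=
  contDiffOn_const.absolutelyContinuousOnInterval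

/-- No sign is assumed, since a calibration may decrease: truncation at `0` raises the integral and
leaves `ENNReal.ofReal` unchanged. -/
theorem ofReal_integral_le_lintegral_ofReal {α : Type*} {m : MeasurableSpace α} {μ : Measure α}
    {f : α → ℝ} (hf : Integrable f μ) :
    ENNReal.ofReal (∫ s, f s ∂μ) ≤ ∫⁻ s, ENNReal.ofReal (f s) ∂μ := by
  calc ENNReal.ofReal (∫ s, f s ∂μ) ≤ ENNReal.ofReal (∫ s, max (f s) 0 ∂μ) :=
        ENNReal.ofReal_le_ofReal (integral_mono hf hf.pos_part fun s ↦ le_max_left _ _)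
    _ = ∫⁻ s, ENNReal.ofReal (max (f s) 0) ∂μ :=
        ofReal_integral_eq_lintegral_ofReal hf.pos_part (ae_of_all _ fun s ↦ le_max_right _ _)
    _ = _ := by simp

/-! ### Lower bounds for the cost by calibration. -/

namespace Steers

variable {T x y x₀ y₀ : ℝ} {ω q₁ q₂ : ℝ → ℝ}

theorem intervalIntegrable_control_mul (h : Steers T x y x₀ y₀ ω q₁ q₂) (hT : 0 < T) :
    IntervalIntegrable (fun τ ↦ ω τ * q₁ τ) volume 0 T := by
  rw [intervalIntegrable_iff_integrableOn_Icc_of_le hT.le]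
  exact h.integrable_control.mul_continuousOn h.continuousOn_fst isCompact_Icc

theorem intervalIntegrable_fst (h : Steers T x y x₀ y₀ ω q₁ q₂) (hT : 0 < T) :
    IntervalIntegrable q₁ volume 0 T :=
  ContinuousOn.intervalIntegrable (by rw [uIcc_of_le hT.le]; exact h.continuousOn_fst)

theorem fst_zero (h : Steers T x y x₀ y₀ ω q₁ q₂) (hT : 0 < T) : q₁ 0 = x := by
  simpa using h.eq_fst 0 ⟨le_rfl, hT.le⟩

theorem snd_zero (h : Steers T x y x₀ y₀ ω q₁ q₂) (hT : 0 < T) : q₂ 0 = y := by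
  simpa using h.eq_snd 0 ⟨le_rfl, hT.le⟩

theorem ac_fst (h : Steers T x y x₀ y₀ ω q₁ q₂) (hT : 0 < T) :
    AbsolutelyContinuousOnInterval q₁ 0 T := by
  refine AbsolutelyContinuousOnInterval.congr_uIcc ((absolutelyContinuousOnInterval_const x 0 T).fun_add
    ((h.intervalIntegrable_control_mul hT).absolutelyContinuousOnInterval_intervalIntegral
      (c := 0) (by simp))) fun s hs ↦ ?_
  rw [uIcc_of_le hT.le] at hs
  exact (h.eq_fst s hs).symm

theorem ac_snd (h : Steers T x y x₀ y₀ ω q₁ q₂) (hT : 0 < T) :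
    AbsolutelyContinuousOnInterval q₂ 0 T := by
  refine AbsolutelyContinuousOnInterval.congr_uIcc ((absolutelyContinuousOnInterval_const y 0 T).fun_add
    ((h.intervalIntegrable_fst hT).absolutelyContinuousOnInterval_intervalIntegral
      (c := 0) (by simp))) fun s hs ↦ ?_
  rw [uIcc_of_le hT.le] at hs
  exact (h.eq_snd s hs).symm

theorem ae_hasDerivAt (h : Steers T x y x₀ y₀ ω q₁ q₂) (hT : 0 < T) :
    ∀ᵐ s, s ∈ Icc 0 T → s ∈ Ioo 0 T ∧ HasDerivAt q₁ (ω s * q₁ s) s ∧ HasDerivAt q₂ (q₁ s) s := by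
  -- The equations hold only on `[0, T]`, so two-sided derivatives need interior points.
  have n0 : ∀ᵐ s : ℝ, s ≠ 0 := by simp [ae_iff, measure_singleton]
  have nT : ∀ᵐ s : ℝ, s ≠ T := by simp [ae_iff, measure_singleton]
  filter_upwards [(h.intervalIntegrable_control_mul hT).ae_hasDerivAt_integral,
    (h.intervalIntegrable_fst hT).ae_hasDerivAt_integral, n0, nT] with s h1 h2 h3 h4 hs
  have hs' : s ∈ Ioo 0 T := ⟨lt_of_le_of_ne hs.1 h3.symm, lt_of_le_of_ne hs.2 h4⟩
  have hnhds : Icc 0 T ∈ nhds s := Icc_mem_nhds hs'.1 hs'.2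
  rw [uIcc_of_le hT.le] at h1 h2
  refine ⟨hs', ?_, ?_⟩
  · refine ((h1 hs 0 ⟨le_rfl, hT.le⟩).const_add x).congr_of_eventuallyEq ?_
    filter_upwards [hnhds] with τ hτ using h.eq_fst τ hτ
  · refine ((h2 hs 0 ⟨le_rfl, hT.le⟩).const_add y).congr_of_eventuallyEq ?_
    filter_upwards [hnhds] with τ hτ using h.eq_snd τ hτ

/-- Calibration: a function along the trajectory whose rate of growth is at most `ω²` bounds the
cost from below. -/
theorem le_controlCost (h : Steers T x y x₀ y₀ ω q₁ q₂) (hT : 0 < T) {F : ℝ → ℝ}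
    (hF : AbsolutelyContinuousOnInterval F 0 T)
    (hle : ∀ s ∈ Ioo 0 T, HasDerivAt q₁ (ω s * q₁ s) s → HasDerivAt q₂ (q₁ s) s →
      ∃ D, HasDerivAt F D s ∧ D ≤ ω s ^ 2) :
    ENNReal.ofReal (F T - F 0) ≤ controlCost T ω := by
  have hint : IntegrableOn (deriv F) (Icc 0 T) := by
    rw [← intervalIntegrable_iff_integrableOn_Icc_of_le hT.le]
    exact hF.intervalIntegrable_deriv
  rw [← hF.integral_deriv_eq_sub, intervalIntegral.integral_of_le hT.le, ← integral_Icc_eq_integral_Ioc]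
  refine (ofReal_integral_le_lintegral_ofReal hint).trans ?_
  refine lintegral_mono_ae ?_
  rw [ae_restrict_iff' measurableSet_Icc]
  filter_upwards [h.ae_hasDerivAt hT] with s hs hmem
  obtain ⟨h0, h1, h2⟩ := hs hmem
  obtain ⟨D, hD, hle'⟩ := hle s h0 h1 h2
  rw [hD.deriv]
  exact ENNReal.ofReal_le_ofReal hle'

theorem snd_mem (h : Steers T x y x₀ y₀ ω q₁ q₂) (hT : 0 < T) {s : ℝ} (hs : s ∈ Icc 0 T) :
    q₂ s ∈ Icc y y₀ := by
  have hmono : MonotoneOn q₂ (Icc 0 T) := by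
    intro a ha b hb hab
    have ii : ∀ c ∈ Icc 0 T, IntervalIntegrable q₁ volume 0 c := fun c hc ↦
      ContinuousOn.intervalIntegrable (by
        rw [uIcc_of_le hc.1]; exact h.continuousOn_fst.mono (Icc_subset_Icc_right hc.2))
    have := intervalIntegral.integral_interval_sub_left (ii b hb) (ii a ha)
    have hnn : 0 ≤ ∫ τ in a..b, q₁ τ := intervalIntegral.integral_nonneg hab fun u hu ↦
      (h.pos_fst u ⟨ha.1.trans hu.1, hu.2.trans hb.2⟩).le
    rw [h.eq_snd a ha, h.eq_snd b hb]
    linarith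
  constructor
  · rw [← h.snd_zero hT]; exact hmono ⟨le_rfl, hT.le⟩ hs hs.1
  · rw [← h.end_snd]; exact hmono hs ⟨hT.le, le_rfl⟩ hs.2

/-- Lower bound for the cost by comparison with a straight segment in polar coordinates
`√q₁ e^{iks}`. -/
theorem cos_le_controlCost (h : Steers T x y x₀ y₀ ω q₁ q₂) (hT : 0 < T) (hx : 0 < x)
    (hx₀ : 0 < x₀) (hy : y < y₀) (k : ℝ) :
    ENNReal.ofReal (-4 * k ^ 2 * T + 4 * (x + x₀) / (y₀ - y)
      - 8 * (Real.cos (k * T) * √(x * x₀)) / (y₀ - y)) ≤ controlCost T ω := by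
  have hd : 0 < y₀ - y := sub_pos.2 hy
  -- `A + iB` is the velocity, with respect to `q₂`, of the chord from `√x` to `√x₀ e^{ikT}`.
  set A := (√x₀ * Real.cos (k * T) - √x) / (y₀ - y) with hA
  set B := √x₀ * Real.sin (k * T) / (y₀ - y) with hB
  let α : ℝ → ℝ := fun s ↦ A * Real.cos (k * s) + B * Real.sin (k * s)
  let β : ℝ → ℝ := fun s ↦ -A * Real.sin (k * s) + B * Real.cos (k * s)
  let F : ℝ → ℝ := fun s ↦ -4 * k ^ 2 * s + -4 * (A ^ 2 + B ^ 2) * q₂ s + 8 * (√(q₁ s) * α s)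
  have hα : ∀ s, HasDerivAt α (k * β s) s := by
    intro s
    have hk : HasDerivAt (fun s ↦ k * s) k s := by simpa using (hasDerivAt_id s).const_mul k
    have := (hk.cos.const_mul A).add (hk.sin.const_mul B)
    refine this.congr_deriv ?_
    simp only [β]; ring
  have hFac : AbsolutelyContinuousOnInterval F 0 T := by
    refine AbsolutelyContinuousOnInterval.fun_add (AbsolutelyContinuousOnInterval.fun_add ?_ ?_) ?_
    · exact ContDiffOn.absolutelyContinuousOnInterval (by fun_prop)
    · exact (h.ac_snd hT).const_mul _
    · refine AbsolutelyContinuousOnInterval.const_mul _ (AbsolutelyContinuousOnInterval.fun_mul ?_ ?_)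
      · refine (h.ac_fst hT).contDiffOn_comp (s := Ioi 0) (G := fun u ↦ √u) ?_ ?_
        · exact fun u hu ↦ (Real.contDiffAt_sqrt (ne_of_gt hu)).contDiffWithinAt
        · intro s hs
          rw [uIcc_of_le hT.le] at hs
          exact h.pos_fst s hs
      · exact ContDiffOn.absolutelyContinuousOnInterval (by simp only [α]; fun_prop)
  have key := h.le_controlCost hT hFac fun s hs h1 h2 ↦ by
    have hq := h.pos_fst s ⟨hs.1.le, hs.2.le⟩
    have hsq : HasDerivAt (fun s ↦ √(q₁ s)) (√(q₁ s) * ω s / 2) s := by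
      refine (h1.sqrt hq.ne').congr_deriv ?_
      have := Real.sqrt_pos.2 hq
      field_simp; linear_combination (-ω s) * Real.sq_sqrt hq.le
    have hid : HasDerivAt (fun s ↦ -4 * k ^ 2 * s) (-4 * k ^ 2) s := by
      simpa only [mul_one, id] using (hasDerivAt_id s).const_mul (-4 * k ^ 2)
    refine ⟨_, (hid.add (h2.const_mul _)).add ((hsq.mul (hα s)).const_mul 8), ?_⟩
    have hαβ : A ^ 2 + B ^ 2 = α s ^ 2 + β s ^ 2 := by
      simp only [α, β]
      linear_combination (-(A ^ 2 + B ^ 2)) * Real.sin_sq_add_cos_sq (k * s)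
    rw [hαβ]
    -- Exactly, `ω² - F' = (ω - 2√q₁ α)² + 4(k - √q₁ β)²`.
    nlinarith [sq_nonneg (ω s - 2 * √(q₁ s) * α s), sq_nonneg (k - √(q₁ s) * β s),
      Real.sq_sqrt hq.le]
  refine le_trans (ENNReal.ofReal_le_ofReal (le_of_eq ?_)) key
  simp only [F, α, h.end_fst, h.end_snd, h.fst_zero hT, h.snd_zero hT, mul_zero, Real.cos_zero,
    Real.sin_zero]
  rw [Real.sqrt_mul hx.le, hA, hB]
  have e1 := Real.sq_sqrt hx.le
  have e2 := Real.sq_sqrt hx₀.le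
  have e3 := Real.sin_sq_add_cos_sq (k * T)
  field_simp
  generalize √x = X at *
  generalize √x₀ = X₀ at *
  subst e1 e2
  linear_combination (-4 * X₀ ^ 2 * (y₀ - y)) * e3

end Steers

/-- The value is a convex combination of `p` and `r`. -/
theorem add_slope_mul_pos {p r d z : ℝ} (hp : 0 < p) (hr : 0 < r) (hd : 0 < d) (hz : z ∈ Icc 0 d) :
    0 < p + (r - p) / d * z := by
  have : p + (r - p) / d * z = (p * (d - z) + r * z) / d := by field_simp; ring
  rw [this]
  apply div_pos _ hd
  rcases eq_or_lt_of_le hz.2 with h | h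
  · rw [h]; nlinarith
  · nlinarith [mul_pos hp (sub_pos.2 h), mul_nonneg hr.le hz.1]

namespace Steers

variable {T x y x₀ y₀ : ℝ} {ω q₁ q₂ : ℝ → ℝ}

/-- Lower bound for the cost by comparison with a straight segment in the hyperbolic coordinates
`√q₁ e^{ks}`, `√q₁ e^{-ks}`. -/
theorem cosh_le_controlCost (h : Steers T x y x₀ y₀ ω q₁ q₂) (hT : 0 < T) (hx : 0 < x)
    (hx₀ : 0 < x₀) (hy : y < y₀) (k : ℝ) :
    ENNReal.ofReal (4 * k ^ 2 * T + 4 * (x + x₀) / (y₀ - y)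
      - 8 * (Real.cosh (k * T) * √(x * x₀)) / (y₀ - y)) ≤ controlCost T ω := by
  have hd : 0 < y₀ - y := sub_pos.2 hy
  have hX := Real.sqrt_pos.2 hx
  have hX₀ := Real.sqrt_pos.2 hx₀
  have hr := mul_pos hX₀ (Real.exp_pos (k * T))
  have hr' := mul_pos hX₀ (Real.exp_pos (-(k * T)))
  -- `a` and `b` below are the two coordinates of the segment as affine functions of `q₂`, with
  -- slopes `A` and `B`; they stay positive because `q₂` stays in `[y, y₀]`.
  set A := (√x₀ * Real.exp (k * T) - √x) / (y₀ - y) with hA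
  set B := (√x₀ * Real.exp (-(k * T)) - √x) / (y₀ - y) with hB
  let a : ℝ → ℝ := fun s ↦ √x + A * (q₂ s - y)
  let b : ℝ → ℝ := fun s ↦ √x + B * (q₂ s - y)
  let F : ℝ → ℝ := fun s ↦ 2 * (q₁ s * (A * (a s)⁻¹ + B * (b s)⁻¹))
    + 4 * k * (Real.log (a s) + -Real.log (b s)) + -4 * k ^ 2 * s
  have hz : ∀ s ∈ Icc 0 T, q₂ s - y ∈ Icc 0 (y₀ - y) := fun s hs ↦ by
    have := h.snd_mem hT hs
    exact ⟨sub_nonneg.2 this.1, by linarith [this.2]⟩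
  have ha : ∀ s ∈ Icc 0 T, 0 < a s := fun s hs ↦ add_slope_mul_pos hX hr hd (hz s hs)
  have hb : ∀ s ∈ Icc 0 T, 0 < b s := fun s hs ↦ add_slope_mul_pos hX hr' hd (hz s hs)
  have hlin : ∀ C, AbsolutelyContinuousOnInterval (fun s ↦ √x + C * (q₂ s - y)) 0 T := fun C ↦
    (absolutelyContinuousOnInterval_const _ _ _).fun_add (((h.ac_snd hT).fun_sub (absolutelyContinuousOnInterval_const _ _ _)).const_mul C)
  have hmaps : ∀ f : ℝ → ℝ, (∀ s ∈ Icc 0 T, 0 < f s) → MapsTo f (uIcc 0 T) (Ioi 0) := by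
    intro f hf s hs
    rw [uIcc_of_le hT.le] at hs
    exact hf s hs
  have hinv : ContDiffOn ℝ 1 (fun u : ℝ ↦ u⁻¹) (Ioi 0) := fun u hu ↦
    (contDiffAt_inv ℝ (ne_of_gt hu)).contDiffWithinAt
  have hlog : ContDiffOn ℝ 1 (fun u : ℝ ↦ Real.log u) (Ioi 0) := fun u hu ↦
    (Real.contDiffAt_log.2 (ne_of_gt hu)).contDiffWithinAt
  have hFac : AbsolutelyContinuousOnInterval F 0 T := by
    refine (((h.ac_fst hT).fun_mul (((hlin A).contDiffOn_comp hinv (hmaps _ ha)).const_mul A |>.fun_add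
      (((hlin B).contDiffOn_comp hinv (hmaps _ hb)).const_mul B))).const_mul 2 |>.fun_add
      ((((hlin A).contDiffOn_comp hlog (hmaps _ ha)).fun_add
        ((hlin B).contDiffOn_comp hlog (hmaps _ hb)).fun_neg).const_mul (4 * k))).fun_add ?_
    exact ContDiffOn.absolutelyContinuousOnInterval (by fun_prop)
  have key := h.le_controlCost hT hFac fun s hs h1 h2 ↦ by
    have hs' : s ∈ Icc 0 T := ⟨hs.1.le, hs.2.le⟩
    have ha' := ha s hs'
    have hb' := hb s hs'
    have hda : HasDerivAt a (A * q₁ s) s := ((h2.sub_const y).const_mul A).const_add _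
    have hdb : HasDerivAt b (B * q₁ s) s := ((h2.sub_const y).const_mul B).const_add _
    have hid : HasDerivAt (fun s ↦ -4 * k ^ 2 * s) (-4 * k ^ 2) s := by
      simpa only [mul_one, id] using (hasDerivAt_id s).const_mul (-4 * k ^ 2)
    refine ⟨_, (((h1.mul (((hda.inv ha'.ne').const_mul A).add ((hdb.inv hb'.ne').const_mul B))).const_mul
      2).add (((hda.log ha'.ne').add (hdb.log hb'.ne').neg).const_mul (4 * k))).add hid, ?_⟩
    simp only [div_eq_mul_inv, Pi.add_apply, Pi.inv_apply, ← inv_pow]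
    generalize (a s)⁻¹ = u
    generalize (b s)⁻¹ = v
    -- `ω² - F'` is the sum of these two squares; the logarithms in `F` supply the cross term of the
    -- second.
    nlinarith [sq_nonneg (ω s - q₁ s * (A * u + B * v)), sq_nonneg (q₁ s * (A * u - B * v) - 2 * k)]
  refine le_trans (ENNReal.ofReal_le_ofReal (le_of_eq ?_)) key
  have haT : a T = √x₀ * Real.exp (k * T) := by
    simp only [a, h.end_snd, hA]; field_simp; ring
  have hbT : b T = √x₀ * Real.exp (-(k * T)) := by
    simp only [b, h.end_snd, hB]; field_simp; ring
  have ha0 : a 0 = √x := by simp [a, h.snd_zero hT]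
  have hb0 : b 0 = √x := by simp [b, h.snd_zero hT]
  simp only [F, haT, hbT, ha0, hb0, h.end_fst, h.fst_zero hT]
  rw [Real.log_mul hX₀.ne' (Real.exp_pos _).ne', Real.log_mul hX₀.ne' (Real.exp_pos _).ne',
    Real.log_exp, Real.log_exp, Real.sqrt_mul hx.le, Real.cosh_eq, hA, hB, Real.exp_neg]
  have e1 := Real.sq_sqrt hx.le
  have e2 := Real.sq_sqrt hx₀.le
  have e3 := Real.exp_pos (k * T)
  generalize √x = X at *
  generalize √x₀ = X₀ at *
  generalize Real.exp (k * T) = e at *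
  subst e1 e2
  field_simp
  ring

end Steers

/-! ### Explicit trajectories and their cost. -/

/-- Given a fundamental system `c`, `w` of `v'' = κ v`, the solution `v` with `v(0) = x^{-1/2}` and
`v(T) = x₀^{-1/2}` yields the trajectory `q₁ = v⁻²` and the control `-2 v' / v`. -/
theorem exists_steers_of_fundamental_system {T x y x₀ y₀ κ : ℝ} {c w : ℝ → ℝ} (hT : 0 < T)
    (hx : 0 < x) (hx₀ : 0 < x₀) (hc : ∀ s, HasDerivAt c (κ * w s) s)
    (hw : ∀ s, HasDerivAt w (c s) s) (hc0 : c 0 = 1) (hw0 : w 0 = 0)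
    (hpos : ∀ s ∈ Ioc 0 T, 0 < w s) (hd : y₀ - y = w T * √(x * x₀)) :
    ∃ ω q₁ q₂, Steers T x y x₀ y₀ ω q₁ q₂ ∧
      0 ≤ 4 * κ * T + 4 * (x + x₀) / (y₀ - y) - 8 * (c T * √(x * x₀)) / (y₀ - y) ∧
      controlCost T ω = ENNReal.ofReal
        (4 * κ * T + 4 * (x + x₀) / (y₀ - y) - 8 * (c T * √(x * x₀)) / (y₀ - y)) := by
  have hwT : 0 < w T := hpos T ⟨hT, le_rfl⟩
  have hX := Real.sqrt_pos.2 hx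
  have hX₀ := Real.sqrt_pos.2 hx₀
  have e1 := Real.sq_sqrt hx.le
  have e2 := Real.sq_sqrt hx₀.le
  rw [Real.sqrt_mul hx.le] at hd ⊢
  generalize √x = X at *
  generalize √x₀ = X₀ at *
  subst e1 e2
  have hrefl : ∀ s, HasDerivAt (fun s ↦ T - s) (-1) s := fun s ↦ (hasDerivAt_id s).const_sub T
  let v : ℝ → ℝ := fun s ↦ (w (T - s) / X + w s / X₀) / w T
  let p : ℝ → ℝ := fun s ↦ (-c (T - s) / X + c s / X₀) / w T
  have hv : ∀ s, HasDerivAt v (p s) s := fun s ↦ by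
    refine (((((hw (T - s)).comp s (hrefl s)).div_const X).add
      ((hw s).div_const X₀)).div_const (w T)).congr_deriv ?_
    simp only [p]; ring
  have hp : ∀ s, HasDerivAt p (κ * v s) s := fun s ↦ by
    refine (((((hc (T - s)).comp s (hrefl s)).neg.div_const X).add
      ((hc s).div_const X₀)).div_const (w T)).congr_deriv ?_
    simp only [v]; ring
  have hvpos : ∀ s ∈ Icc 0 T, 0 < v s := by
    intro s hs
    refine div_pos ?_ hwT
    have hnn : ∀ τ ∈ Icc 0 T, 0 ≤ w τ := fun τ hτ ↦ by
      rcases eq_or_lt_of_le hτ.1 with h | h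
      · rw [← h, hw0]
      · exact (hpos τ ⟨h, hτ.2⟩).le
    have h2 := hnn (T - s) ⟨by linarith [hs.2], by linarith [hs.1]⟩
    rcases eq_or_lt_of_le hs.1 with h | h
    · subst h
      rw [hw0, sub_zero]; positivity
    · have := hpos s ⟨h, hs.2⟩
      positivity
  have hv0 : v 0 = X⁻¹ := by simp only [v, hw0, sub_zero]; field_simp; simp
  have hvT : v T = X₀⁻¹ := by simp only [v, hw0, sub_self]; field_simp; simp
  -- The Wronskian of `w` and `v` is constant; hence `(w / v)' = X⁻¹ v⁻²`, which integrates `q₁`.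
  have hW : ∀ s, c s * v s - w s * p s = X⁻¹ := by
    have hder : ∀ s, HasDerivAt (fun s ↦ c s * v s - w s * p s) 0 s := fun s ↦ by
      refine (((hc s).mul (hv s)).sub ((hw s).mul (hp s))).congr_deriv ?_
      ring
    intro s
    have := is_const_of_deriv_eq_zero (fun s ↦ (hder s).differentiableAt)
      (fun s ↦ (hder s).deriv) s 0
    simpa [hc0, hw0, hv0] using this
  have hvcont : Continuous v := continuous_iff_continuousAt.2 fun s ↦ (hv s).continuousAt
  have hpcont : Continuous p := continuous_iff_continuousAt.2 fun s ↦ (hp s).continuousAt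
  have hvne : ∀ s ∈ Icc 0 T, v s ≠ 0 := fun s hs ↦ (hvpos s hs).ne'
  let ω : ℝ → ℝ := fun s ↦ -2 * p s / v s
  let q₁ : ℝ → ℝ := fun s ↦ (v s ^ 2)⁻¹
  let q₂ : ℝ → ℝ := fun s ↦ y + X * (w s / v s)
  -- An antiderivative of `ω²`, by the Riccati equation `(p / v)' = κ - (p / v)²`.
  let J : ℝ → ℝ := fun s ↦ 4 * (κ * s) - 4 * (p s / v s)
  have hωc : ContinuousOn ω (Icc 0 T) :=
    (continuous_const.mul hpcont).continuousOn.div hvcont.continuousOn hvne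
  have hq₁c : ContinuousOn q₁ (Icc 0 T) :=
    (hvcont.pow 2).continuousOn.inv₀ fun s hs ↦ pow_ne_zero 2 (hvne s hs)
  have hq₁ : ∀ s ∈ Icc 0 T, HasDerivAt q₁ (ω s * q₁ s) s := fun s hs ↦ by
    refine (((hv s).pow 2).inv (pow_ne_zero 2 (hvne s hs))).congr_deriv ?_
    have := hvne s hs
    simp only [ω, q₁, Pi.pow_apply]; field_simp; simp; ring
  have hq₂ : ∀ s ∈ Icc 0 T, HasDerivAt q₂ (q₁ s) s := fun s hs ↦ by
    refine ((((hw s).div (hv s) (hvne s hs)).const_mul X).const_add y).congr_deriv ?_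
    rw [hW s]
    simp only [q₁]; field_simp
  have hJ : ∀ s ∈ Icc 0 T, HasDerivAt J (ω s ^ 2) s := fun s hs ↦ by
    refine ((((hasDerivAt_id s).const_mul κ).const_mul 4).sub
      (((hp s).div (hv s) (hvne s hs)).const_mul 4)).congr_deriv ?_
    have := hvne s hs
    simp only [ω]; field_simp; ring
  have ftc : ∀ {f f' : ℝ → ℝ}, (∀ s ∈ Icc 0 T, HasDerivAt f (f' s) s) → ContinuousOn f' (Icc 0 T) →
      ∀ s ∈ Icc 0 T, f s = f 0 + ∫ τ in (0 : ℝ)..s, f' τ := fun hf hf' s hs ↦ by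
    have hsub : uIcc 0 s ⊆ Icc 0 T := by
      rw [uIcc_of_le hs.1]; exact Icc_subset_Icc_right hs.2
    rw [intervalIntegral.integral_eq_sub_of_hasDerivAt (fun τ hτ ↦ hf τ (hsub hτ))
      (hf'.mono hsub).intervalIntegrable]
    ring
  have hcost : 4 * κ * T + 4 * (X ^ 2 + X₀ ^ 2) / (y₀ - y) - 8 * (c T * (X * X₀)) / (y₀ - y)
      = ∫ s in Icc 0 T, ω s ^ 2 := by
    have h1 := ftc hJ (hωc.pow 2) T ⟨hT.le, le_rfl⟩
    rw [integral_Icc_eq_integral_Ioc, ← intervalIntegral.integral_of_le hT.le,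
      ← sub_eq_iff_eq_add'.2 h1]
    simp only [J, hv0, hvT, p, sub_self, sub_zero, hc0, hd]
    field_simp
    ring
  refine ⟨ω, q₁, q₂, ⟨hωc.integrableOn_Icc, hq₁c, fun s hs ↦ inv_pos.2 (pow_pos (hvpos s hs) 2),
    ?_, ?_, ?_, ?_⟩, ?_, ?_⟩
  · have : q₁ 0 = X ^ 2 := by simp [q₁, hv0]
    rw [← this]
    exact ftc hq₁ (hωc.mul hq₁c)
  · have : q₂ 0 = y := by simp [q₂, hw0]
    intro s hs
    rw [ftc hq₂ hq₁c s hs, this]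
  · simp [q₁, hvT]
  · simp only [q₂, hvT]
    rw [div_inv_eq_mul]
    linarith
  · rw [hcost]
    exact integral_nonneg fun s ↦ sq_nonneg _
  · have hint : Integrable (fun s ↦ ω s ^ 2) (volume.restrict (Icc 0 T)) :=
      ContinuousOn.integrableOn_Icc (μ := volume) (hωc.pow 2)
    rw [hcost, controlCost, ofReal_integral_eq_lintegral_ofReal hint
      (ae_of_all _ fun s ↦ sq_nonneg _)]

/-! ### The value function in terms of `r`. -/

/-- `cosh √r` for `r > 0`, `cos √(-r)` otherwise. -/
noncomputable def cosFun (r : ℝ) : ℝ := if 0 < r then Real.cosh (√r) else Real.cos (√(-r))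

theorem sqrt_neg_lt_pi {r : ℝ} (hr : -Real.pi ^ 2 < r) : √(-r) < Real.pi := by
  rw [Real.sqrt_lt' Real.pi_pos]; linarith

theorem valueFunction_eq_of_bounds {x y t x₀ y₀ t₀ K : ℝ} (ht : t₀ < t)
    (hlow : ∀ ω q₁ q₂, Steers (t - t₀) x y x₀ y₀ ω q₁ q₂ →
      ENNReal.ofReal K ≤ controlCost (t - t₀) ω)
    (hup : ∃ ω q₁ q₂, Steers (t - t₀) x y x₀ y₀ ω q₁ q₂ ∧ 0 ≤ K ∧
      controlCost (t - t₀) ω = ENNReal.ofReal K) :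
    valueFunction x y t x₀ y₀ t₀ ≠ ⊤ ∧ (valueFunction x y t x₀ y₀ t₀).toReal = K := by
  obtain ⟨ω, q₁, q₂, hs, hK, hcost⟩ := hup
  have : valueFunction x y t x₀ y₀ t₀ = ENNReal.ofReal K := by
    apply le_antisymm
    · rw [← hcost]
      exact iInf₂_le ω ⟨ht, q₁, q₂, hs⟩
    · exact le_iInf₂ fun ω' ⟨_, q, q', hs'⟩ ↦ hlow ω' q q' hs'
  rw [this]
  exact ⟨ENNReal.ofReal_ne_top, ENNReal.toReal_ofReal hK⟩

/-- With `κ = r / T²` and `k = √|r| / T` the lower bound and the cost of the explicit control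
coincide. The condition `r > -π²` keeps `sin (k s)` positive on `(0, T]` when `r < 0`. -/
theorem valueFunction_eq {x y t x₀ y₀ t₀ r : ℝ} (hx : 0 < x) (hx₀ : 0 < x₀) (ht : t₀ < t)
    (hy : y < y₀) (hr : -Real.pi ^ 2 < r) (hd : y₀ - y = (t - t₀) * gFun r * √(x * x₀)) :
    valueFunction x y t x₀ y₀ t₀ ≠ ⊤ ∧ (valueFunction x y t x₀ y₀ t₀).toReal =
      4 * r / (t - t₀) + 4 * (x + x₀) / (y₀ - y) - 8 * (cosFun r * √(x * x₀)) / (y₀ - y) := by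
  have hT : 0 < t - t₀ := sub_pos.2 ht
  generalize hTdef : t - t₀ = T at *
  have hlin : ∀ k s : ℝ, HasDerivAt (fun s ↦ k * s) k s := fun k s ↦ by
    simpa only [mul_one, id] using (hasDerivAt_id s).const_mul k
  rcases lt_trichotomy r 0 with h | h | h
  · have hu : 0 < √(-r) := Real.sqrt_pos.2 (neg_pos.2 h)
    have huπ := sqrt_neg_lt_pi hr
    have hsq : √(-r) ^ 2 = -r := Real.sq_sqrt (neg_pos.2 h).le
    rw [gFun, if_neg h.not_gt, if_neg h.ne] at hd
    rw [cosFun, if_neg h.not_gt]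
    generalize √(-r) = u at *
    obtain rfl : r = -u ^ 2 := by linarith
    have hkT : u / T * T = u := by field_simp
    have hk : u / T ≠ 0 := by positivity
    have hK : 4 * -u ^ 2 / T + 4 * (x + x₀) / (y₀ - y) - 8 * (Real.cos u * √(x * x₀)) / (y₀ - y)
        = -4 * (u / T) ^ 2 * T + 4 * (x + x₀) / (y₀ - y)
          - 8 * (Real.cos (u / T * T) * √(x * x₀)) / (y₀ - y) := by
      rw [hkT]; congr 2; field_simp
    rw [hK]
    apply valueFunction_eq_of_bounds ht
    · rw [hTdef]
      exact fun ω q₁ q₂ hs ↦ hs.cos_le_controlCost hT hx hx₀ hy _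
    · rw [hTdef]
      have := exists_steers_of_fundamental_system (y := y) (y₀ := y₀) (κ := -(u / T) ^ 2)
        (c := fun s ↦ Real.cos (u / T * s)) (w := fun s ↦ Real.sin (u / T * s) / (u / T)) hT hx hx₀
        (fun s ↦ ((hlin _ s).cos).congr_deriv (by field_simp))
        (fun s ↦ (((hlin _ s).sin).div_const _).congr_deriv (by field_simp)) (by simp) (by simp)
        (fun s hs ↦ div_pos (Real.sin_pos_of_pos_of_lt_pi (mul_pos (by positivity) hs.1)
          (lt_of_le_of_lt (by
            calc u / T * s ≤ u / T * T := by gcongr; exact hs.2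
              _ = u := hkT) huπ)) (by positivity))
        (by rw [hd, hkT]; field_simp)
      rwa [show 4 * -(u / T) ^ 2 * T = -4 * (u / T) ^ 2 * T by ring] at this
  · subst h
    have hK : 4 * 0 / T + 4 * (x + x₀) / (y₀ - y) - 8 * (cosFun 0 * √(x * x₀)) / (y₀ - y)
        = -4 * 0 ^ 2 * T + 4 * (x + x₀) / (y₀ - y)
          - 8 * (Real.cos (0 * T) * √(x * x₀)) / (y₀ - y) := by
      simp [cosFun]
    rw [hK]
    apply valueFunction_eq_of_bounds ht
    · rw [hTdef]
      exact fun ω q₁ q₂ hs ↦ hs.cos_le_controlCost hT hx hx₀ hy _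
    · rw [hTdef]
      have := exists_steers_of_fundamental_system (y := y) (y₀ := y₀) (κ := 0)
        (c := fun _ ↦ 1) (w := fun s ↦ s) hT hx hx₀
        (fun s ↦ (hasDerivAt_const s _).congr_deriv (by simp)) (fun s ↦ hasDerivAt_id s) rfl rfl
        (fun s hs ↦ hs.1) (by rw [hd]; simp [gFun])
      simpa using this
  · have hu : 0 < √r := Real.sqrt_pos.2 h
    have hsq : √r ^ 2 = r := Real.sq_sqrt h.le
    rw [gFun, if_pos h] at hd
    rw [cosFun, if_pos h]
    generalize √r = u at *
    subst hsq
    have hkT : u / T * T = u := by field_simp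
    have hk : u / T ≠ 0 := by positivity
    have hK : 4 * u ^ 2 / T + 4 * (x + x₀) / (y₀ - y) - 8 * (Real.cosh u * √(x * x₀)) / (y₀ - y)
        = 4 * (u / T) ^ 2 * T + 4 * (x + x₀) / (y₀ - y)
          - 8 * (Real.cosh (u / T * T) * √(x * x₀)) / (y₀ - y) := by
      rw [hkT]; congr 2; field_simp
    rw [hK]
    apply valueFunction_eq_of_bounds ht
    · rw [hTdef]
      exact fun ω q₁ q₂ hs ↦ hs.cosh_le_controlCost hT hx hx₀ hy _
    · rw [hTdef]
      exact exists_steers_of_fundamental_system (y := y) (y₀ := y₀) (κ := (u / T) ^ 2)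
        (c := fun s ↦ Real.cosh (u / T * s)) (w := fun s ↦ Real.sinh (u / T * s) / (u / T)) hT hx hx₀
        (fun s ↦ ((hlin _ s).cosh).congr_deriv (by field_simp))
        (fun s ↦ (((hlin _ s).sinh).div_const _).congr_deriv (by field_simp)) (by simp) (by simp)
        (fun s hs ↦ div_pos (Real.sinh_pos_iff.2 (mul_pos (by positivity) hs.1)) (by positivity))
        (by rw [hd, hkT]; field_simp)

/-! ### Monotonicity and bijectivity of `g`; signs of `cosFun`. -/

theorem gFun_of_neg {r : ℝ} (h : r < 0) : gFun r = Real.sin (√(-r)) / √(-r) := by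
  rw [gFun, if_neg h.not_gt, if_neg h.ne]

theorem gFun_of_pos {r : ℝ} (h : 0 < r) : gFun r = Real.sinh (√r) / √r := if_pos h

theorem gFun_zero : gFun 0 = 1 := by simp [gFun]

theorem gFun_sq {u : ℝ} (h : 0 < u) : gFun (u ^ 2) = Real.sinh u / u := by
  rw [gFun_of_pos (pow_pos h 2), Real.sqrt_sq h.le]

theorem gFun_neg_sq {u : ℝ} (h : 0 < u) : gFun (-u ^ 2) = Real.sin u / u := by
  rw [gFun_of_neg (neg_neg_of_pos (pow_pos h 2)), neg_neg, Real.sqrt_sq h.le]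

theorem cosFun_sq {u : ℝ} (h : 0 < u) : cosFun (u ^ 2) = Real.cosh u := by
  rw [cosFun, if_pos (pow_pos h 2), Real.sqrt_sq h.le]

theorem cosFun_neg_sq {u : ℝ} (h : 0 ≤ u) : cosFun (-u ^ 2) = Real.cos u := by
  rw [cosFun, if_neg (by nlinarith [sq_nonneg u]), neg_neg, Real.sqrt_sq h]

/-- The quotient is a secant slope from the origin, and sine is strictly concave there. -/
theorem sin_div_strictAntiOn : StrictAntiOn (fun u : ℝ ↦ Real.sin u / u) (Ioo 0 Real.pi) := by
  intro a ha b hb hab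
  simpa using strictConcaveOn_sin_Icc.secant_strict_mono (a := 0) ⟨le_rfl, Real.pi_pos.le⟩
    (Ioo_subset_Icc_self ha) (Ioo_subset_Icc_self hb) ha.1.ne' hb.1.ne' hab

theorem sinh_div_strictMonoOn : StrictMonoOn (fun u : ℝ ↦ Real.sinh u / u) (Ioi 0) := by
  have hconv : StrictConvexOn ℝ (Ici 0) Real.sinh := by
    refine StrictMonoOn.strictConvexOn_of_deriv (convex_Ici 0) Real.continuous_sinh.continuousOn ?_
    rw [Real.deriv_sinh, interior_Ici]
    exact Real.cosh_strictMonoOn.mono Ioi_subset_Ici_self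
  intro a ha b hb hab
  simpa using hconv.secant_strict_mono (a := 0) (mem_Ici.2 le_rfl) (Ioi_subset_Ici_self ha)
    (Ioi_subset_Ici_self hb) (ne_of_gt ha) (ne_of_gt hb) hab

theorem sqrt_neg_mem {r : ℝ} (hr : -Real.pi ^ 2 < r) (h : r < 0) : √(-r) ∈ Ioo 0 Real.pi :=
  ⟨Real.sqrt_pos.2 (neg_pos.2 h), sqrt_neg_lt_pi hr⟩

theorem gFun_lt_one {r : ℝ} (h : r < 0) : gFun r < 1 := by
  have := Real.sqrt_pos.2 (neg_pos.2 h)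
  rw [gFun_of_neg h, div_lt_one this]
  exact Real.sin_lt this

theorem one_lt_gFun {r : ℝ} (h : 0 < r) : 1 < gFun r := by
  have := Real.sqrt_pos.2 h
  rw [gFun_of_pos h, one_lt_div this]
  exact Real.self_lt_sinh_iff.2 this

theorem gFun_strictMonoOn : StrictMonoOn gFun (Ioi (-Real.pi ^ 2)) := by
  intro a ha b hb hab
  rcases lt_trichotomy a 0 with h | h | h
  · rcases lt_trichotomy b 0 with h' | h' | h'
    · rw [gFun_of_neg h, gFun_of_neg h']
      exact sin_div_strictAntiOn (sqrt_neg_mem hb h') (sqrt_neg_mem ha h)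
        (Real.sqrt_lt_sqrt (neg_nonneg.2 h'.le) (neg_lt_neg hab))
    · rw [h', gFun_zero]; exact gFun_lt_one h
    · exact (gFun_lt_one h).trans (one_lt_gFun h')
  · rw [h, gFun_zero]; exact one_lt_gFun (h ▸ hab)
  · rw [gFun_of_pos h, gFun_of_pos (h.trans hab)]
    exact sinh_div_strictMonoOn (Real.sqrt_pos.2 h) (Real.sqrt_pos.2 (h.trans hab))
      (Real.sqrt_lt_sqrt h.le hab)

theorem gFun_pos {r : ℝ} (hr : -Real.pi ^ 2 < r) : 0 < gFun r := by
  rcases lt_trichotomy r 0 with h | h | h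
  · have := sqrt_neg_mem hr h
    rw [gFun_of_neg h]
    exact div_pos (Real.sin_pos_of_pos_of_lt_pi this.1 this.2) this.1
  · rw [h, gFun_zero]; exact one_pos
  · exact one_pos.trans (one_lt_gFun h)

/-- `dslope` fills the removable singularity of `f u / u` at `0`, so that the intermediate value
theorem applies on intervals starting at `0`. -/
theorem continuous_dslope_zero {f : ℝ → ℝ} (hf : Differentiable ℝ f) :
    Continuous (dslope f 0) := by
  refine continuous_iff_continuousAt.2 fun u ↦ ?_
  rcases eq_or_ne u 0 with h | h
  · rw [h]; exact continuousAt_dslope_same.2 (hf 0)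
  · exact (continuousAt_dslope_of_ne h).2 (hf u).continuousAt

theorem dslope_zero_of_ne {f : ℝ → ℝ} (hf : f 0 = 0) {u : ℝ} (hu : u ≠ 0) :
    dslope f 0 u = f u / u := by
  rw [dslope_of_ne _ hu, slope_def_field, hf, sub_zero, sub_zero]

theorem gFun_bijOn : BijOn gFun (Ioi (-Real.pi ^ 2)) (Ioi 0) := by
  refine ⟨fun r hr ↦ gFun_pos hr, gFun_strictMonoOn.injOn, fun ρ hρ ↦ ?_⟩
  have hρ : 0 < ρ := hρ
  rcases lt_trichotomy ρ 1 with h | h | h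
  · have hc := (continuous_dslope_zero Real.differentiable_sin).continuousOn (s := Icc 0 Real.pi)
    have h0 : dslope Real.sin 0 0 = 1 := by simp
    have hπ : dslope Real.sin 0 Real.pi = 0 := by
      rw [dslope_zero_of_ne Real.sin_zero Real.pi_ne_zero]; simp
    obtain ⟨u, hu, he⟩ := intermediate_value_Ioo' Real.pi_pos.le hc
      (show ρ ∈ Ioo _ _ by rw [h0, hπ]; exact ⟨hρ, h⟩)
    refine ⟨-u ^ 2, neg_lt_neg (pow_lt_pow_left₀ hu.2 hu.1.le two_ne_zero), ?_⟩
    rw [gFun_neg_sq hu.1, ← he, dslope_zero_of_ne Real.sin_zero hu.1.ne']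
  · exact ⟨0, neg_neg_of_pos (pow_pos Real.pi_pos 2), by rw [gFun_zero, h]⟩
  -- At `u = 4ρ`, `exp u ≥ 1 + u + u²/2` gives `sinh u ≥ 4ρ² + 2ρ > ρ u`.
  · have hc := (continuous_dslope_zero Real.differentiable_sinh).continuousOn (s := Icc 0 (4 * ρ))
    have h0 : dslope Real.sinh 0 0 = 1 := by simp
    have h1 : ρ < dslope Real.sinh 0 (4 * ρ) := by
      have hp : 0 < 4 * ρ := by positivity
      rw [dslope_zero_of_ne Real.sinh_zero hp.ne', lt_div_iff₀ hp, Real.sinh_eq]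
      have := Real.quadratic_le_exp_of_nonneg hp.le
      have : Real.exp (-(4 * ρ)) ≤ 1 := Real.exp_le_one_iff.2 (by linarith)
      nlinarith
    obtain ⟨u, hu, he⟩ := intermediate_value_Ioo (by positivity) hc
      (show ρ ∈ Ioo _ _ by rw [h0]; exact ⟨h, h1⟩)
    refine ⟨u ^ 2, ?_, ?_⟩
    · exact (neg_nonpos.2 (sq_nonneg _)).trans_lt (pow_pos hu.1 2)
    · rw [gFun_sq hu.1, ← he, dslope_zero_of_ne Real.sinh_zero hu.1.ne']

theorem cosFun_sq_eq (r : ℝ) : cosFun r ^ 2 = 1 + r * gFun r ^ 2 := by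
  rcases lt_trichotomy r 0 with h | h | h
  · obtain ⟨u, hu, rfl⟩ : ∃ u, 0 < u ∧ r = -u ^ 2 :=
      ⟨√(-r), Real.sqrt_pos.2 (neg_pos.2 h), by rw [Real.sq_sqrt (neg_pos.2 h).le, neg_neg]⟩
    rw [cosFun_neg_sq hu.le, gFun_neg_sq hu, Real.cos_sq']
    field_simp; ring
  · simp [h, cosFun]
  · obtain ⟨u, hu, rfl⟩ : ∃ u, 0 < u ∧ r = u ^ 2 :=
      ⟨√r, Real.sqrt_pos.2 h, (Real.sq_sqrt h.le).symm⟩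
    rw [cosFun_sq hu, gFun_sq hu, Real.cosh_sq']
    field_simp

/-- The threshold `r = -π²/4` is `E = -π²/T²`, where the formula changes branch. -/
theorem cosFun_nonneg {r : ℝ} (h : -Real.pi ^ 2 / 4 ≤ r) : 0 ≤ cosFun r := by
  rw [cosFun]
  split_ifs
  · exact (Real.cosh_pos _).le
  · refine Real.cos_nonneg_of_neg_pi_div_two_le_of_le
      (by linarith [Real.sqrt_nonneg (-r), Real.pi_pos]) ?_
    rw [Real.sqrt_le_left (by linarith [Real.pi_pos])]
    linarith

theorem cosFun_nonpos {r : ℝ} (hr : -Real.pi ^ 2 < r) (h : r < -Real.pi ^ 2 / 4) :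
    cosFun r ≤ 0 := by
  have h0 : r < 0 := by nlinarith [Real.pi_pos]
  rw [cosFun, if_neg h0.not_gt]
  refine Real.cos_nonpos_of_pi_div_two_le_of_le ?_
    (by linarith [sqrt_neg_lt_pi hr, Real.pi_pos])
  exact Real.le_sqrt_of_sq_le (by linarith)

/-! ### Asymptotics for large and small `ρ`. -/

theorem tendsto_log_sinh_div_atTop :
    Tendsto (fun u : ℝ ↦ Real.log (Real.sinh u / u) / u) atTop (𝓝 1) := by
  have hlow : Tendsto (fun u : ℝ ↦ 1 - Real.log 4 / u - Real.log u / u) atTop (𝓝 1) := by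
    have h1 : Tendsto (fun u : ℝ ↦ Real.log 4 / u) atTop (𝓝 0) :=
      tendsto_const_nhds.div_atTop tendsto_id
    have h2 : Tendsto (fun u : ℝ ↦ Real.log u / u) atTop (𝓝 0) :=
      Real.isLittleO_log_id_atTop.tendsto_div_nhds_zero
    simpa using (tendsto_const_nhds.sub h1).sub h2
  refine tendsto_of_tendsto_of_tendsto_of_le_of_le' hlow tendsto_const_nhds ?_ ?_
  · filter_upwards [eventually_ge_atTop 1] with u hu
    have hu0 : 0 < u := by linarith
    have hs : Real.exp u / 4 ≤ Real.sinh u := by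
      rw [Real.sinh_eq]
      have : Real.exp (-u) ≤ 1 := Real.exp_le_one_iff.2 (by linarith)
      have := Real.add_one_le_exp u
      linarith
    have : u - Real.log 4 - Real.log u ≤ Real.log (Real.sinh u / u) := by
      rw [Real.log_div (Real.sinh_pos_iff.2 hu0).ne' hu0.ne']
      have := Real.log_le_log (by positivity) hs
      rw [Real.log_div (Real.exp_pos u).ne' four_ne_zero, Real.log_exp] at this
      linarith
    rw [le_div_iff₀ hu0]
    refine le_trans (le_of_eq ?_) this
    field_simp
  · filter_upwards [eventually_ge_atTop 1] with u hu
    have hu0 : 0 < u := by linarith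
    rw [div_le_one hu0, Real.log_le_iff_le_exp (div_pos (Real.sinh_pos_iff.2 hu0) hu0)]
    refine (div_le_self (Real.sinh_pos_iff.2 hu0).le hu).trans ?_
    rw [Real.sinh_eq]
    linarith [Real.exp_pos u, Real.exp_pos (-u)]

/-- After division by `u²` the numerator is `1 - 2 coth u / u`, with `coth u ≤ 2` for `u ≥ 1`, and
the logarithm is asymptotic to `u`. -/
theorem tendsto_sq_sub_coth_div_log_sq :
    Tendsto (fun u : ℝ ↦ (u ^ 2 - 2 * (Real.cosh u / (Real.sinh u / u)))
      / Real.log (Real.sinh u / u) ^ 2) atTop (𝓝 1) := by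
  have h1 : Tendsto (fun u : ℝ ↦ 1 - 2 * (Real.cosh u / Real.sinh u) / u) atTop (𝓝 1) := by
    have hlow : Tendsto (fun u : ℝ ↦ 1 - 4 / u) atTop (𝓝 1) := by
      simpa using tendsto_const_nhds.sub (tendsto_const_nhds.div_atTop tendsto_id :
        Tendsto (fun u : ℝ ↦ 4 / u) atTop (𝓝 0))
    refine tendsto_of_tendsto_of_tendsto_of_le_of_le' hlow tendsto_const_nhds ?_ ?_
    · filter_upwards [eventually_ge_atTop 1] with u hu
      have hu0 : 0 < u := by linarith
      have : Real.cosh u / Real.sinh u ≤ 2 := by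
        rw [div_le_iff₀ (Real.sinh_pos_iff.2 hu0), Real.sinh_eq, Real.cosh_eq]
        have h3 : Real.exp (-u) ≤ 1 := Real.exp_le_one_iff.2 (by linarith)
        have := Real.quadratic_le_exp_of_nonneg hu0.le
        have h4 : Real.exp (-u) * Real.exp u = 1 := by rw [← Real.exp_add]; simp
        nlinarith [Real.exp_pos (-u)]
      have : 2 * (Real.cosh u / Real.sinh u) / u ≤ 4 / u := by gcongr; linarith
      linarith
    · filter_upwards [eventually_gt_atTop 0] with u hu
      have := Real.sinh_pos_iff.2 hu
      have : 0 ≤ 2 * (Real.cosh u / Real.sinh u) / u := by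
        have := Real.cosh_pos u
        positivity
      linarith
  have h2 := h1.div (tendsto_log_sinh_div_atTop.pow 2) (by norm_num)
  rw [one_pow, div_one] at h2
  refine h2.congr' ?_
  filter_upwards [eventually_gt_atTop 0] with u hu
  have := (Real.sinh_pos_iff.2 hu).ne'
  simp only [Pi.div_apply]
  field_simp

theorem exists_bound_gFun_large {ε : ℝ} (hε : 0 < ε) : ∃ R, 0 < R ∧ ∀ r, -Real.pi ^ 2 < r →
    R < gFun r → 0 < Real.log (gFun r) ∧
      |r - 2 * (cosFun r / gFun r) - Real.log (gFun r) ^ 2| < ε * Real.log (gFun r) ^ 2 := by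
  obtain ⟨u₀, hu₀⟩ := eventually_atTop.1 (Metric.tendsto_nhds.1 tendsto_sq_sub_coth_div_log_sq ε hε)
  have hm : 0 < max u₀ 1 := lt_max_of_lt_right one_pos
  have hmem : -Real.pi ^ 2 < max u₀ 1 ^ 2 :=
    (neg_nonpos.2 (sq_nonneg _)).trans_lt (pow_pos hm 2)
  refine ⟨gFun (max u₀ 1 ^ 2), gFun_pos hmem, fun r hr hlt ↦ ?_⟩
  have hlt' := (gFun_strictMonoOn.lt_iff_lt hmem hr).1 hlt
  have hr0 : 0 < r := (pow_pos hm 2).trans hlt'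
  have hlog := Real.log_pos (one_lt_gFun hr0)
  refine ⟨hlog, ?_⟩
  obtain ⟨u, hu, rfl⟩ : ∃ u, 0 < u ∧ r = u ^ 2 :=
    ⟨√r, Real.sqrt_pos.2 hr0, (Real.sq_sqrt hr0.le).symm⟩
  have hle : u₀ ≤ u := (le_max_left _ _).trans (lt_of_pow_lt_pow_left₀ 2 hu.le hlt').le
  have key := hu₀ u hle
  rw [gFun_sq hu] at hlog ⊢
  rw [cosFun_sq hu]
  have hL := pow_pos hlog 2
  rw [Real.dist_eq, div_sub_one hL.ne', abs_div, abs_of_pos hL, div_lt_iff₀ hL] at key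
  exact key

/-- Small `g(-u²)` forces `u` near `π`. At `u = π` both strict inequalities hold, as `0 < 4` and `0
< 4ε`, so they persist nearby by continuity. -/
theorem exists_bound_gFun_small {ε : ℝ} (hε : 0 < ε) : ∃ δ, 0 < δ ∧ ∀ r, -Real.pi ^ 2 < r →
    gFun r < δ → Real.pi ^ 2 * gFun r < 4 ∧
      |(r + Real.pi ^ 2) * gFun r - 2 * (cosFun r + 1)| < ε * (4 - Real.pi ^ 2 * gFun r) := by
  have hπ := Real.pi_pos
  have hc : ContinuousAt (fun u : ℝ ↦ Real.sin u / u) Real.pi :=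
    Real.continuous_sin.continuousAt.div continuousAt_id hπ.ne'
  have hev : ∀ᶠ u in 𝓝 Real.pi, Real.pi ^ 2 * (Real.sin u / u) < 4 ∧
      |(-u ^ 2 + Real.pi ^ 2) * (Real.sin u / u) - 2 * (Real.cos u + 1)|
        < ε * (4 - Real.pi ^ 2 * (Real.sin u / u)) := by
    refine Filter.Eventually.and ?_ ?_
    · exact (continuousAt_const.mul hc).eventually_lt continuousAt_const (by simp)
    · refine ContinuousAt.eventually_lt (ContinuousAt.abs (ContinuousAt.sub
        (ContinuousAt.mul (by fun_prop) hc) (by fun_prop)))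
        (continuousAt_const.mul (continuousAt_const.sub (continuousAt_const.mul hc))) ?_
      simpa using hε
  obtain ⟨η, hη, H⟩ := Metric.eventually_nhds_iff.1 hev
  -- `π/2` only keeps `m` positive when `η` is large.
  set m := max (Real.pi - η) (Real.pi / 2) with hm
  have hm0 : 0 < m := lt_max_of_lt_right (by positivity)
  have hmπ : m < Real.pi := max_lt (by linarith) (by linarith)
  have hmem : -Real.pi ^ 2 < -m ^ 2 := neg_lt_neg (pow_lt_pow_left₀ hmπ hm0.le two_ne_zero)
  refine ⟨gFun (-m ^ 2), gFun_pos hmem, fun r hr hlt ↦ ?_⟩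
  have hlt' := (gFun_strictMonoOn.lt_iff_lt hr hmem).1 hlt
  have hr0 : r < 0 := hlt'.trans (neg_neg_of_pos (pow_pos hm0 2))
  have huπ := sqrt_neg_lt_pi hr
  obtain ⟨u, hu, rfl, hueq⟩ : ∃ u, 0 < u ∧ r = -u ^ 2 ∧ u = √(-r) :=
    ⟨√(-r), Real.sqrt_pos.2 (neg_pos.2 hr0), by rw [Real.sq_sqrt (neg_pos.2 hr0).le, neg_neg], rfl⟩
  rw [← hueq] at huπ
  have hmu : m < u := lt_of_pow_lt_pow_left₀ 2 hu.le (neg_lt_neg_iff.1 hlt')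
  rw [gFun_neg_sq hu, cosFun_neg_sq hu.le]
  refine H ?_
  rw [Real.dist_eq, abs_lt]
  exact ⟨by linarith [le_max_left (Real.pi - η) (Real.pi / 2)], by linarith⟩

/-! ### Translation to `E` and `ρ`. -/

section Formula

variable {x y t x₀ y₀ t₀ : ℝ}

theorem steeringRatio_pos (hx : 0 < x) (hx₀ : 0 < x₀) (ht : t₀ < t) (hy : y < y₀) :
    0 < steeringRatio x y t x₀ y₀ t₀ :=
  div_pos (sub_pos.2 hy) (mul_pos (sub_pos.2 ht) (Real.sqrt_pos.2 (mul_pos hx hx₀)))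

theorem gInv_mem {ρ : ℝ} (hρ : 0 < ρ) : -Real.pi ^ 2 < gInv ρ :=
  Function.invFunOn_mem (gFun_bijOn.surjOn hρ)

theorem gFun_gInv {ρ : ℝ} (hρ : 0 < ρ) : gFun (gInv ρ) = ρ :=
  Function.invFunOn_eq (gFun_bijOn.surjOn hρ)

theorem sqrt_mul_div_eq (hx : 0 < x) (hx₀ : 0 < x₀) (ht : t₀ < t) (hy : y < y₀) :
    √(x * x₀) / (y₀ - y) = 1 / ((t - t₀) * steeringRatio x y t x₀ y₀ t₀) := by
  have := sub_pos.2 ht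
  have := sub_pos.2 hy
  have := Real.sqrt_pos.2 (mul_pos hx hx₀)
  rw [steeringRatio]
  field_simp

theorem valueFunction_eq_gInv (hx : 0 < x) (hx₀ : 0 < x₀) (ht : t₀ < t) (hy : y < y₀) :
    valueFunction x y t x₀ y₀ t₀ ≠ ⊤ ∧ (valueFunction x y t x₀ y₀ t₀).toReal =
      4 * gInv (steeringRatio x y t x₀ y₀ t₀) / (t - t₀) + 4 * (x + x₀) / (y₀ - y)
        - 8 * cosFun (gInv (steeringRatio x y t x₀ y₀ t₀))
          / ((t - t₀) * steeringRatio x y t x₀ y₀ t₀) := by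
  have hρ := steeringRatio_pos hx hx₀ ht hy
  have h := valueFunction_eq hx hx₀ ht hy (gInv_mem hρ) (by
    rw [gFun_gInv hρ, steeringRatio]
    have := sub_pos.2 ht
    have := Real.sqrt_pos.2 (mul_pos hx hx₀)
    field_simp)
  refine ⟨h.1, h.2.trans ?_⟩
  rw [← mul_assoc, mul_div_assoc _ (√(x * x₀)), sqrt_mul_div_eq hx hx₀ ht hy, mul_one_div]

theorem energyE_add_eq_sq (hx : 0 < x) (hx₀ : 0 < x₀) (ht : t₀ < t) (hy : y < y₀) :
    energyE x y t x₀ y₀ t₀ + 4 * x * x₀ / (y₀ - y) ^ 2 =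
      (2 * cosFun (gInv (steeringRatio x y t x₀ y₀ t₀))
        / ((t - t₀) * steeringRatio x y t x₀ y₀ t₀)) ^ 2 := by
  have hρ := steeringRatio_pos hx hx₀ ht hy
  have hT := sub_pos.2 ht
  have h1 : 4 * x * x₀ / (y₀ - y) ^ 2 = 4 * (1 / ((t - t₀) * steeringRatio x y t x₀ y₀ t₀)) ^ 2 := by
    rw [← sqrt_mul_div_eq hx hx₀ ht hy, div_pow, Real.sq_sqrt (mul_pos hx hx₀).le]
    ring
  have h2 := cosFun_sq_eq (gInv (steeringRatio x y t x₀ y₀ t₀))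
  rw [gFun_gInv hρ] at h2
  rw [h1, div_pow (2 * _), mul_pow 2, h2, energyE]
  field_simp
  ring

end Formula

theorem proposition1p3 :
    -- `g` is a bijection from `(-π², ∞)` onto `(0, ∞)`, so that `E` is well defined
    BijOn gFun (Ioi (-Real.pi ^ 2)) (Ioi 0) ∧
    -- the explicit formula
    (∀ x y t x₀ y₀ t₀ : ℝ, 0 < x → 0 < x₀ → t₀ < t → y < y₀ →
      valueFunction x y t x₀ y₀ t₀ ≠ ⊤ ∧
      -4 * Real.pi ^ 2 / (t - t₀) ^ 2 < energyE x y t x₀ y₀ t₀ ∧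
      0 ≤ energyE x y t x₀ y₀ t₀ + 4 * x * x₀ / (y₀ - y) ^ 2 ∧
      (-Real.pi ^ 2 / (t - t₀) ^ 2 ≤ energyE x y t x₀ y₀ t₀ →
        (valueFunction x y t x₀ y₀ t₀).toReal =
          energyE x y t x₀ y₀ t₀ * (t - t₀) + 4 * (x + x₀) / (y₀ - y)
            - 4 * √(energyE x y t x₀ y₀ t₀ + 4 * x * x₀ / (y₀ - y) ^ 2)) ∧
      (-4 * Real.pi ^ 2 / (t - t₀) ^ 2 < energyE x y t x₀ y₀ t₀ →
        energyE x y t x₀ y₀ t₀ < -Real.pi ^ 2 / (t - t₀) ^ 2 →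
        (valueFunction x y t x₀ y₀ t₀).toReal =
          energyE x y t x₀ y₀ t₀ * (t - t₀) + 4 * (x + x₀) / (y₀ - y)
            + 4 * √(energyE x y t x₀ y₀ t₀ + 4 * x * x₀ / (y₀ - y) ^ 2))) ∧
    -- the asymptotics as the ratio tends to `+∞`, uniformly in all the variables
    (∀ ε : ℝ, 0 < ε → ∃ R : ℝ, 0 < R ∧
      ∀ x y t x₀ y₀ t₀ : ℝ, 0 < x → 0 < x₀ → t₀ < t → y < y₀ →
        R < steeringRatio x y t x₀ y₀ t₀ →
        |(valueFunction x y t x₀ y₀ t₀).toReal /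
            (4 / (t - t₀) * Real.log (steeringRatio x y t x₀ y₀ t₀) ^ 2
              + 4 * (x₀ + x) / (y₀ - y)) - 1| < ε) ∧
    -- the asymptotics as the ratio tends to `0`, uniformly in all the variables
    (∀ ε : ℝ, 0 < ε → ∃ δ : ℝ, 0 < δ ∧
      ∀ x y t x₀ y₀ t₀ : ℝ, 0 < x → 0 < x₀ → t₀ < t → y < y₀ →
        steeringRatio x y t x₀ y₀ t₀ < δ →
        |(valueFunction x y t x₀ y₀ t₀).toReal /
            (4 * (√x + √x₀) ^ 2 / (y₀ - y) - 4 * Real.pi ^ 2 / (t - t₀)) - 1| < ε) := by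
  refine ⟨gFun_bijOn, ?_, ?_, ?_⟩
  · intro x y t x₀ y₀ t₀ hx hx₀ ht hy
    have hρ := steeringRatio_pos hx hx₀ ht hy
    have hT := sub_pos.2 ht
    obtain ⟨hfin, hval⟩ := valueFunction_eq_gInv hx hx₀ ht hy
    have hr := gInv_mem hρ
    rw [energyE_add_eq_sq hx hx₀ ht hy, hval, energyE, Real.sqrt_sq_eq_abs, abs_div, abs_mul,
      abs_of_pos (mul_pos hT hρ), abs_two]
    generalize gInv (steeringRatio x y t x₀ y₀ t₀) = r at *
    generalize steeringRatio x y t x₀ y₀ t₀ = ρ at *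
    have hE : 4 / (t - t₀) ^ 2 * r = 4 * r / (t - t₀) ^ 2 := by ring
    have hET : 4 / (t - t₀) ^ 2 * r * (t - t₀) = 4 * r / (t - t₀) := by field_simp
    rw [hET, hE]
    refine ⟨hfin, ?_, sq_nonneg _, fun h ↦ ?_, fun _ h ↦ ?_⟩
    · rw [div_lt_div_iff_of_pos_right (by positivity)]
      linarith
    · rw [div_le_div_iff_of_pos_right (by positivity)] at h
      rw [abs_of_nonneg (cosFun_nonneg (by linarith))]
      ring
    · rw [div_lt_div_iff_of_pos_right (by positivity)] at h
      rw [abs_of_nonpos (cosFun_nonpos hr (by linarith))]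
      ring
  · intro ε hε
    obtain ⟨R, hR, H⟩ := exists_bound_gFun_large hε
    refine ⟨R, hR, fun x y t x₀ y₀ t₀ hx hx₀ ht hy hlt ↦ ?_⟩
    have hρ := steeringRatio_pos hx hx₀ ht hy
    have hT := sub_pos.2 ht
    have hd := sub_pos.2 hy
    rw [(valueFunction_eq_gInv hx hx₀ ht hy).2]
    have h := H _ (gInv_mem hρ) (by rwa [gFun_gInv hρ])
    rw [gFun_gInv hρ] at h
    obtain ⟨hlog, h⟩ := h
    generalize gInv (steeringRatio x y t x₀ y₀ t₀) = r at *
    generalize steeringRatio x y t x₀ y₀ t₀ = ρ at *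
    have hN : 0 < 4 / (t - t₀) * Real.log ρ ^ 2 + 4 * (x₀ + x) / (y₀ - y) := by positivity
    rw [div_sub_one hN.ne', abs_div, abs_of_pos hN, div_lt_iff₀ hN]
    -- The terms in `x + x₀` cancel, leaving a function of `ρ` alone times `4/T`.
    have e : 4 * r / (t - t₀) + 4 * (x + x₀) / (y₀ - y) - 8 * cosFun r / ((t - t₀) * ρ)
        - (4 / (t - t₀) * Real.log ρ ^ 2 + 4 * (x₀ + x) / (y₀ - y))
        = 4 / (t - t₀) * (r - 2 * (cosFun r / ρ) - Real.log ρ ^ 2) := by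
      field_simp; ring
    rw [e, abs_mul, abs_of_pos (by positivity)]
    calc _ < 4 / (t - t₀) * (ε * Real.log ρ ^ 2) := by gcongr
      _ = ε * (4 / (t - t₀) * Real.log ρ ^ 2) := by ring
      _ ≤ _ := by
        gcongr
        have : 0 ≤ 4 * (x₀ + x) / (y₀ - y) := by positivity
        linarith
  · intro ε hε
    obtain ⟨δ, hδ, H⟩ := exists_bound_gFun_small hε
    refine ⟨δ, hδ, fun x y t x₀ y₀ t₀ hx hx₀ ht hy hlt ↦ ?_⟩
    have hρ := steeringRatio_pos hx hx₀ ht hy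
    have hT := sub_pos.2 ht
    have hd := sub_pos.2 hy
    have hsq := sqrt_mul_div_eq hx hx₀ ht hy
    rw [(valueFunction_eq_gInv hx hx₀ ht hy).2]
    have h := H _ (gInv_mem hρ) (by rwa [gFun_gInv hρ])
    rw [gFun_gInv hρ] at h
    obtain ⟨h4, h⟩ := h
    generalize gInv (steeringRatio x y t x₀ y₀ t₀) = r at *
    generalize steeringRatio x y t x₀ y₀ t₀ = ρ at *
    have hexp : 4 * (√x + √x₀) ^ 2 / (y₀ - y) = 4 * (x + x₀) / (y₀ - y) + 8 / ((t - t₀) * ρ) := by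
      have : (√x + √x₀) ^ 2 = x + x₀ + 2 * √(x * x₀) := by
        rw [Real.sqrt_mul hx.le, add_sq, Real.sq_sqrt hx.le, Real.sq_sqrt hx₀.le]; ring
      rw [this, ← mul_one_div 8, ← hsq]
      ring
    -- AM-GM bounds the denominator below by `4/(Tρ) · (4 - π²ρ)`, which carries the same factor
    -- `4/(Tρ)` as the error.
    have hamgm : 8 / ((t - t₀) * ρ) ≤ 4 * (x + x₀) / (y₀ - y) := by
      have : 2 * √(x * x₀) ≤ x + x₀ := by
        rw [Real.sqrt_mul hx.le]
        nlinarith [sq_nonneg (√x - √x₀), Real.sq_sqrt hx.le, Real.sq_sqrt hx₀.le]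
      rw [← mul_one_div 8, ← hsq, ← mul_div_assoc,
        div_le_div_iff_of_pos_right hd]
      linarith
    have hNle : 4 / ((t - t₀) * ρ) * (4 - Real.pi ^ 2 * ρ) ≤
        4 * (√x + √x₀) ^ 2 / (y₀ - y) - 4 * Real.pi ^ 2 / (t - t₀) := by
      have : 4 / ((t - t₀) * ρ) * (4 - Real.pi ^ 2 * ρ)
          = 8 / ((t - t₀) * ρ) + 8 / ((t - t₀) * ρ) - 4 * Real.pi ^ 2 / (t - t₀) := by
        field_simp; ring
      rw [hexp, this]
      linarith
    have hN : 0 < 4 * (√x + √x₀) ^ 2 / (y₀ - y) - 4 * Real.pi ^ 2 / (t - t₀) :=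
      lt_of_lt_of_le (mul_pos (by positivity) (by linarith)) hNle
    rw [div_sub_one hN.ne', abs_div, abs_of_pos hN, div_lt_iff₀ hN]
    have e : 4 * r / (t - t₀) + 4 * (x + x₀) / (y₀ - y) - 8 * cosFun r / ((t - t₀) * ρ)
        - (4 * (√x + √x₀) ^ 2 / (y₀ - y) - 4 * Real.pi ^ 2 / (t - t₀))
        = 4 / ((t - t₀) * ρ) * ((r + Real.pi ^ 2) * ρ - 2 * (cosFun r + 1)) := by
      rw [hexp]; field_simp; ring
    rw [e, abs_mul, abs_of_pos (by positivity)]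
    calc _ < 4 / ((t - t₀) * ρ) * (ε * (4 - Real.pi ^ 2 * ρ)) := by gcongr
      _ = ε * (4 / ((t - t₀) * ρ) * (4 - Real.pi ^ 2 * ρ)) := by ring
      _ ≤ _ := by gcongr
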